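/- Let $K, M$ be integers with $1 < M \le K$. For a finite field $\mathbb{F}_q$ and $L\ge 1$, a server stores $K$ messages $W_1,\dots,W_K\in\mathbb{F}_q^L$, i.i.d. uniform. Let $\mathcal S$ be uniform over the $M$-element subsets of $[K]=\{1,\dots,K\}$, let $\theta$ be uniform over $\mathcal S$ given $\mathcal S$, and let $\Lambda=(\lambda_1,\dots,\lambda_M)$ be uniform over $(\mathbb{F}_q^\times)^M$, where $(\theta,\mathcal S)$, $\Lambda$ and $W_{[K]}=(W_1,\dots,W_K)$ are independent. A user knows $\theta$, $\mathcal S$, $\Lambda$ and the coded side information $Y=\lambda_1W_{\mathcal S(1)}+\cdots+\lambda_MW_{\mathcal S(M)}$, where $\mathcal S(1)<\cdots<\mathcal S(M)$ are the elements of $\mathcal S$. The user sends a random query $Q$ with a discrete alphabet such that $W_{[K]}$ is independent of $(Q,\theta,\mathcal S,\Lambda)$, and the server returns an answer $\Delta$ that is a function of $(Q,W_{[K]})$. The scheme is achievable if it is private, i.e. $I(\theta,\mathcal S;Q,W_{[K]})=0$, and correct, i.e. $W_\theta$ is almost surely a function of $(\Delta,Q,Y,\mathcal S,\Lambda,\theta)$.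 Its rate is $L/D$, where $D$ is the average download in $q$-ary symbols: the answer is a string over a finite alphabet of size $b\ge2$, the possible strings for each given query form a uniquely decodable code, and $D$ is the expected length of the string times $\log_q b$. The capacity $C_{\text{PCSI-II}}(q)$ is the supremum of the rates of achievable schemes over all $L$, and $C^{\sup}_{\text{PCSI-II}}=\sup_q C_{\text{PCSI-II}}(q)$, the supremum being over all finite fields. Then $$C^{\sup}_{\text{PCSI-II}}=\max\left(\frac2K,\frac1{K-M+1}\right)=\begin{cases}\dfrac2K, & 1<M\le\dfrac{K+1}2,\\[2mm] \dfrac1{K-M+1}, & \dfrac{K+1}2<M\le K.\end{cases}$$ -/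

import Mathlib

open scoped ENNReal

namespace PCSI

/-- A support index set: a set of exactly `M` of the `K` message indices. -/
abbrev Support (K M : ℕ) : Type := {S : Finset (Fin K) // S.card = M}

lemma support_nonempty {K M : ℕ} (hMK : M ≤ K) : Nonempty (Support K M) := by
  obtain ⟨S, -, hS⟩ := Finset.exists_subset_card_eq
    (s := (Finset.univ : Finset (Fin K))) (n := M) (by simpa using hMK)
  exact ⟨⟨S, hS⟩⟩

lemma Support.finset_nonempty {K M : ℕ} (hM : 1 < M) (S : Support K M) : S.1.Nonempty :=
  Finset.card_pos.mp (by rw [S.2]; omega)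

/-- The `K` messages, each a vector of `L` symbols of the field `F`. -/
abbrev Messages (F : Type) (K L : ℕ) : Type := Fin K → Fin L → F

/-- The coded side information `λ₁ W_{S(1)} + ⋯ + λ_M W_{S(M)}`, where `S(1) < ⋯ < S(M)` are the
elements of `S` in ascending order. -/
def sideInfo {F : Type} [Field F] {K M L : ℕ} (S : Support K M) (Λ : Fin M → Fˣ)
    (W : Messages F K L) : Fin L → F :=
  ∑ m : Fin M, (Λ m : F) • W (S.1.orderEmbOfFin S.2 m)

/-- A joint realization of all the random quantities: support index set, demand index,
coefficient vector, messages, query. -/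
structure Outcome (F : Type) [Field F] (K M L : ℕ) (Query : Type) where
  S : Support K M
  θ : Fin K
  Λ : Fin M → Fˣ
  W : Messages F K L
  Q : Query

/-- Independence of two (discrete) random variables `X` and `Y` under `p`, i.e. the vanishing of
their mutual information: the joint law is the product of the marginal laws. -/
def Indep {Ω α β : Type} (p : PMF Ω) (X : Ω → α) (Y : Ω → β) : Prop :=
  ∀ a b, p.map (fun ω => (X ω, Y ω)) (a, b) = p.map X a * p.map Y b

/-- A retrieval scheme. The user draws a query at random given `(S, θ, Λ)` only, so that it is
independent of the messages. The server's answer is a function of the query and the messages; it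
is a string over a finite alphabet, and for each query the possible strings form a uniquely
decodable code. -/
structure Scheme (F : Type) [Field F] (K M : ℕ) where
  /-- message length, in symbols of `F` -/
  L : ℕ
  L_pos : 0 < L
  /-- the query alphabet -/
  Query : Type
  /-- conditional law of the query given `(S, θ, Λ)` -/
  query : Support K M → Fin K → (Fin M → Fˣ) → PMF Query
  /-- the alphabet of the symbols that are downloaded -/
  Letter : Type
  [fintypeLetter : Fintype Letter]
  [nontrivialLetter : Nontrivial Letter]
  answer : Query → Messages F K L → List Letter
  answer_code : ∀ Q, InformationTheory.UniquelyDecodable (Set.range (answer Q))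

attribute [instance] Scheme.fintypeLetter Scheme.nontrivialLetter

namespace Scheme

variable {F : Type} [Field F] [Fintype F] {K M : ℕ}

open Classical in
/-- The joint law: `S` is uniform over the `M`-subsets of the index set, `θ` is uniform over `S`
given `S`, the coefficient vector is uniform over the vectors of nonzero scalars, the messages are
uniform, and `(θ, S)`, `Λ`, `W` are independent; the query is drawn from its kernel. -/
noncomputable def law (s : Scheme F K M) (hM : 1 < M) (hMK : M ≤ K) :
    PMF (Outcome F K M s.L s.Query) :=
  haveI := support_nonempty hMK
  (PMF.uniformOfFintype (Support K M)).bind fun S =>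
  (PMF.uniformOfFinset S.1 (S.finset_nonempty hM)).bind fun θ =>
  (PMF.uniformOfFintype (Fin M → Fˣ)).bind fun Λ =>
  (PMF.uniformOfFintype (Messages F K s.L)).bind fun W =>
  (s.query S θ Λ).map fun Q => ⟨S, θ, Λ, W, Q⟩

/-- Privacy: `(θ, S)` is independent of `(Q, W)`. -/
def Private (s : Scheme F K M) (hM : 1 < M) (hMK : M ≤ K) : Prop :=
  Indep (s.law hM hMK) (fun o => (o.θ, o.S)) (fun o => (o.Q, o.W))

/-- Correctness: almost surely, the desired message is a function of the answer, the query,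
the coded side information, the support index set, the coefficients and the demand index. -/
def Correct (s : Scheme F K M) (hM : 1 < M) (hMK : M ≤ K) : Prop :=
  ∃ decode : List s.Letter → s.Query → (Fin s.L → F) → Support K M → (Fin M → Fˣ) → Fin K →
      (Fin s.L → F),
    ∀ o ∈ (s.law hM hMK).support,
      decode (s.answer o.Q o.W) o.Q (sideInfo o.S o.Λ o.W) o.S o.Λ o.θ = o.W o.θ

/-- The average download `D`, measured in `q`-ary symbols with `q = |F|`: the expected length of
the answer, where a letter of an alphabet of size `b` counts as `log_q b` `q`-ary symbols. -/
noncomputable def download (s : Scheme F K M) (hM : 1 < M) (hMK : M ≤ K) : ℝ≥0∞ :=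
  (∑' o, s.law hM hMK o * ((s.answer o.Q o.W).length : ℝ≥0∞)) *
    ENNReal.ofReal (Real.logb (Fintype.card F) (Fintype.card s.Letter))

/-- The rate `L / D`. -/
noncomputable def rate (s : Scheme F K M) (hM : 1 < M) (hMK : M ≤ K) : ℝ≥0∞ :=
  (s.L : ℝ≥0∞) / s.download hM hMK

end Scheme

/-- The capacity of PIR-PCSI-II over the finite field `F`: the supremum, over all message lengths
and all private and correct schemes, of the rate. -/
noncomputable def capacity (F : Type) [Field F] [Fintype F] (K M : ℕ) (hM : 1 < M)
    (hMK : M ≤ K) : ℝ≥0∞ :=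
  ⨆ (s : Scheme F K M) (_ : s.Private hM hMK) (_ : s.Correct hM hMK), s.rate hM hMK

/-- The supremum of the capacity over all finite fields. -/
noncomputable def supCapacity (K M : ℕ) (hM : 1 < M) (hMK : M ≤ K) : ℝ≥0∞ :=
  ⨆ (F : Type) (_ : Field F) (_ : Fintype F), capacity F K M hM hMK

end PCSI

set_option linter.unusedSectionVars false

namespace PCSI

open Finset in
/-- Every set of `M` messages admits, for each of its members `θ`, a linear combination with
nonzero coefficients whose value determines `W θ` among the message tuples in `A`. -/
def Recoverable (F : Type) [Field F] {ι V : Type} [AddCommGroup V] [Module F V] (M : ℕ)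
    (A : Finset (ι → V)) : Prop :=
  ∀ S : Finset ι, #S = M → ∀ θ ∈ S, ∃ c : ι → F, (∀ i ∈ S, c i ≠ 0) ∧
    ∀ W ∈ A, ∀ W' ∈ A, ∑ i ∈ S, c i • W i = ∑ i ∈ S, c i • W' i → W θ = W' θ

/-! ### Counting message tuples that share an answer -/

section Combinatorics

open Finset

variable {F : Type} [Field F] {ι V : Type} [Fintype ι] [DecidableEq ι] [AddCommGroup V]
  [Module F V] [Fintype V] [DecidableEq V] {M : ℕ} {A : Finset (ι → V)}

lemma eq_of_sum_eq {S : Finset ι} {c : ι → F} {W W' : ι → V} {j : ι} (hj : j ∈ S)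
    (hc : c j ≠ 0) (h : ∑ i ∈ S, c i • W i = ∑ i ∈ S, c i • W' i)
    (hne : ∀ i ∈ S, i ≠ j → W i = W' i) : W j = W' j := by
  rw [← Finset.add_sum_erase _ _ hj, ← Finset.add_sum_erase _ _ hj] at h
  have h2 : ∑ i ∈ S.erase j, c i • W i = ∑ i ∈ S.erase j, c i • W' i :=
    Finset.sum_congr rfl fun i hi => by
      rw [hne i (Finset.mem_of_mem_erase hi) (Finset.ne_of_mem_erase hi)]
  rw [h2] at h
  exact smul_right_injective V hc (add_right_cancel h)

/-- `n` combinations, together with the messages in `E`, determine `2n` further messages. -/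
lemma Recoverable.exists_combinations (hA : Recoverable F M A) (hM : 2 ≤ M) {n : ℕ}
    (j t : Fin n → ι) (E : Finset ι) (hjt : ∀ a b, j a ≠ t b) (hjE : ∀ a, j a ∉ E)
    (hcard : M - 1 ≤ #(E ∪ univ.image t)) :
    ∃ f : (ι → V) → (Fin n → V), ∀ W ∈ A, ∀ W' ∈ A, (∀ k ∈ E, W k = W' k) → f W = f W' →
      ∀ a, W (j a) = W' (j a) ∧ W (t a) = W' (t a) := by
  -- The `a`-th combination is supported on `T a` together with `j a`, with demand `t a`. Once all
  -- the `t b` are recovered, `j a` is its only unknown term.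
  have hS : ∀ a, ∃ T : Finset ι, {t a} ⊆ T ∧ T ⊆ E ∪ univ.image t ∧ #T = M - 1 := fun a =>
    exists_subsuperset_card_eq (by simp) (by simp; omega) hcard
  choose T htT hTE hTc using hS
  have hjT : ∀ a, j a ∉ T a := fun a h => by
    have := hTE a h
    simp only [mem_union, mem_image, mem_univ, true_and] at this
    rcases this with h | ⟨b, hb⟩
    · exact hjE a h
    · exact hjt a b hb.symm
  have hc := fun a => hA (insert (j a) (T a)) (by rw [card_insert_of_notMem (hjT a), hTc]; omega)
    (t a) (mem_insert_of_mem (htT a (mem_singleton_self _)))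
  choose c hc0 hc using hc
  refine ⟨fun W a => ∑ i ∈ insert (j a) (T a), c a i • W i, fun W hW W' hW' hE hf => ?_⟩
  have ht : ∀ a, W (t a) = W' (t a) := fun a => hc a W hW W' hW' (congrFun hf a)
  refine fun a => ⟨?_, ht a⟩
  refine eq_of_sum_eq (mem_insert_self _ _) (hc0 a _ (mem_insert_self _ _)) (congrFun hf a) ?_
  intro i hi hij
  have := hTE a (mem_of_mem_insert_of_ne hi hij)
  simp only [mem_union, mem_image, mem_univ, true_and] at this
  rcases this with h | ⟨b, rfl⟩
  · exact hE i h
  · exact ht b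

lemma exists_disjoint_injections {n : ℕ} (P : Finset ι) (hP : 2 * n ≤ #P) :
    ∃ j t : Fin n → ι, Function.Injective j ∧ Function.Injective t ∧ (∀ a b, j a ≠ t b) ∧
      (∀ a, j a ∈ P) ∧ ∀ a, t a ∈ P := by
  have : Nonempty ((Fin n ⊕ Fin n) ↪ P) := by
    rw [Function.Embedding.nonempty_iff_card_le]; simp; omega
  obtain ⟨e⟩ := this
  refine ⟨fun a => e (Sum.inl a), fun a => e (Sum.inr a), ?_, ?_, ?_, ?_, ?_⟩
  · intro a b h; simpa using h
  · intro a b h; simpa using h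
  · intro a b h; simpa using (Subtype.ext h)
  · intro a; exact (e _).2
  · intro a; exact (e _).2

lemma covers_of_card {n : ℕ} {P : Finset ι} (hP : #P = 2 * n) {j t : Fin n → ι}
    (hj : Function.Injective j) (ht : Function.Injective t) (hjt : ∀ a b, j a ≠ t b)
    (hjP : ∀ a, j a ∈ P) (htP : ∀ a, t a ∈ P) {i : ι} (hi : i ∈ P) :
    ∃ a, i = j a ∨ i = t a := by
  have hd : Disjoint (univ.image j) (univ.image t) := by
    rw [disjoint_left]; intro x hx hx'
    simp only [mem_image, mem_univ, true_and] at hx hx'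
    obtain ⟨a, rfl⟩ := hx
    obtain ⟨b, hb⟩ := hx'
    exact hjt a b hb.symm
  have : univ.image j ∪ univ.image t = P := by
    apply eq_of_subset_of_card_le
    · intro x hx
      simp only [mem_union, mem_image, mem_univ, true_and] at hx
      rcases hx with ⟨a, rfl⟩ | ⟨a, rfl⟩
      · exact hjP a
      · exact htP a
    · rw [card_union_of_disjoint hd, card_image_of_injective _ hj, card_image_of_injective _ ht]
      simp; omega
  rw [← this] at hi
  simp only [mem_union, mem_image, mem_univ, true_and] at hi
  rcases hi with ⟨a, rfl⟩ | ⟨a, rfl⟩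
  · exact ⟨a, Or.inl rfl⟩
  · exact ⟨a, Or.inr rfl⟩

/-- With `K = Fintype.card ι`, take `K - M + 1` pairs and reveal the remaining `2M - K - 2` messages
outright. These and the `t a` number exactly `M - 1`, just enough to fill the supports, and the
total count of revealed values is also `M - 1`. -/
lemma Recoverable.card_le_of_large (hA : Recoverable F M A) (hM : 2 ≤ M)
    (hMK : M ≤ Fintype.card ι) (h : Fintype.card ι + 2 ≤ 2 * M) :
    #A ≤ Fintype.card V ^ (M - 1) := by
  obtain ⟨j, t, hj, ht, hjt, -, -⟩ := exists_disjoint_injections (ι := ι)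
    (n := Fintype.card ι - M + 1) univ (by rw [card_univ]; omega)
  have hd : Disjoint (univ.image j) (univ.image t) := by
    rw [disjoint_left]; intro x hx hx'
    simp only [mem_image, mem_univ, true_and] at hx hx'
    obtain ⟨a, rfl⟩ := hx
    obtain ⟨b, hb⟩ := hx'
    exact hjt a b hb.symm
  set E : Finset ι := (univ.image j ∪ univ.image t)ᶜ with hE
  have hEc : #E = Fintype.card ι - 2 * (Fintype.card ι - M + 1) := by
    rw [hE, card_compl, card_union_of_disjoint hd, card_image_of_injective _ hj,
      card_image_of_injective _ ht]
    simp; omega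
  have hjE : ∀ a, j a ∉ E := fun a => by simp [hE]
  have hdE : Disjoint E (univ.image t) := by
    rw [disjoint_left]; intro x hx hx'
    rw [hE, mem_compl, mem_union] at hx
    exact hx (Or.inr hx')
  obtain ⟨f, hf⟩ := hA.exists_combinations hM j t E hjt hjE (by
    rw [card_union_of_disjoint hdE, hEc, card_image_of_injective _ ht]; simp; omega)
  have hinj : Set.InjOn (fun W : ι → V => (f W, fun k : E => W k)) A := by
    intro W hW W' hW' h
    simp only [Prod.mk.injEq] at h
    have hk : ∀ k ∈ E, W k = W' k := fun k hk => congrFun h.2 ⟨k, hk⟩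
    have := hf W hW W' hW' hk h.1
    funext i
    by_cases hi : i ∈ E
    · exact hk i hi
    · rw [hE, mem_compl, not_not, mem_union] at hi
      simp only [mem_image, mem_univ, true_and] at hi
      rcases hi with ⟨a, rfl⟩ | ⟨a, rfl⟩
      · exact (this a).1
      · exact (this a).2
  have := card_le_card_of_injOn _ (t := univ) (fun _ _ => by simp) hinj
  refine this.trans_eq ?_
  rw [card_univ, Fintype.card_prod]
  simp only [Fintype.card_fun, Fintype.card_fin, Fintype.card_coe, hEc, ← pow_add]
  congr 1; omega

lemma Recoverable.exists_determines (hA : Recoverable F M A) (hM : 2 ≤ M) {n : ℕ}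
    {P : Finset ι} (hP : #P = 2 * n) (hn : M ≤ n + 1) :
    ∃ f : (ι → V) → (Fin n → V), ∀ W ∈ A, ∀ W' ∈ A, f W = f W' → ∀ i ∈ P, W i = W' i := by
  obtain ⟨j, t, hj, ht, hjt, hjP, htP⟩ := exists_disjoint_injections P hP.ge
  obtain ⟨f, hf⟩ := hA.exists_combinations hM j t ∅ hjt (by simp) (by
    rw [empty_union, card_image_of_injective _ ht]; simp; omega)
  refine ⟨f, fun W hW W' hW' h i hi => ?_⟩
  obtain ⟨a, rfl | rfl⟩ := covers_of_card hP hj ht hjt hjP htP hi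
  · exact (hf W hW W' hW' (by simp) h a).1
  · exact (hf W hW W' hW' (by simp) h a).2

lemma Recoverable.card_le_of_even (hA : Recoverable F M A) (hM : 2 ≤ M) {n : ℕ}
    (hn : Fintype.card ι = 2 * n) (h : M ≤ n + 1) : #A ≤ Fintype.card V ^ n := by
  obtain ⟨f, hf⟩ := hA.exists_determines hM (P := univ) (n := n) (by rw [card_univ, hn]) h
  have hinj : Set.InjOn f A := fun W hW W' hW' h => funext fun i => hf W hW W' hW' h i (mem_univ i)
  exact (card_le_card_of_injOn f (t := univ) (fun _ _ => by simp) hinj).trans_eq (by simp)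

/-- The message tuples of `A` that agree with `W` except possibly at `k`. -/
def line (A : Finset (ι → V)) (k : ι) (W : ι → V) : Finset (ι → V) :=
  {W' ∈ A | ∀ i, i ≠ k → W i = W' i}

lemma mem_line {k : ι} {W W' : ι → V} :
    W' ∈ line A k W ↔ W' ∈ A ∧ ∀ i, i ≠ k → W i = W' i := by simp [line]

lemma card_line_pos {k : ι} {W : ι → V} (hW : W ∈ A) : 0 < #(line A k W) :=
  card_pos.mpr ⟨W, mem_line.mpr ⟨hW, fun _ _ => rfl⟩⟩

/-- Each line in direction `k` contributes 1 to the sum, which therefore counts the lines meeting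
`A`; `f` takes different values on different lines. -/
lemma sum_inv_card_line_le {N : ℕ} {k : ι} {X : Type} [Fintype X] (hX : Fintype.card X = N)
    (f : (ι → V) → X)
    (hf : ∀ W ∈ A, ∀ W' ∈ A, f W = f W' → ∀ i, i ≠ k → W i = W' i) :
    ∑ W ∈ A, ((#(line A k W) : ℝ))⁻¹ ≤ N := by
  classical
  set g : (ι → V) → (ι → V) := fun W => Function.update W k 0
  have hg : ∀ W W' : ι → V, g W = g W' ↔ ∀ i, i ≠ k → W i = W' i := by
    intro W W'
    constructor
    · intro h i hi
      have := congrFun h i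
      simpa [g, hi] using this
    · intro h; funext i
      by_cases hi : i = k
      · subst hi; simp [g]
      · simp [g, hi, h i hi]
  have h1 : ∑ W ∈ A, ((#(line A k W) : ℝ))⁻¹ = #(A.image g) := by
    rw [← Finset.sum_fiberwise_of_maps_to (t := A.image g) (g := g)
      (fun W hW => mem_image_of_mem _ hW)]
    rw [card_eq_sum_ones, Nat.cast_sum]
    refine sum_congr rfl fun b hb => ?_
    obtain ⟨W0, hW0, rfl⟩ := mem_image.mp hb
    have : ∀ W ∈ A.filter (fun W => g W = g W0),
        ((#(line A k W) : ℝ))⁻¹ = (#(A.filter fun W => g W = g W0) : ℝ)⁻¹ := by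
      intro W hW
      congr 3
      ext W'
      rw [mem_line, mem_filter, ← hg, (mem_filter.mp hW).2, eq_comm]
    rw [sum_congr rfl this, sum_const, nsmul_eq_mul, mul_inv_cancel₀]
    · simp
    · have : 0 < #(A.filter fun W => g W = g W0) := card_pos.mpr ⟨W0, by simp [hW0]⟩
      positivity
  rw [h1]
  have : #(A.image g) ≤ #(A.image f) := by
    have : ∀ b ∈ A.image g, ∃ W ∈ A, g W = b := fun b hb => by simpa using hb
    choose! s hsA hs using this
    refine card_le_card_of_injOn (fun b => f (s b)) (fun b hb => mem_image_of_mem _ (hsA b hb)) ?_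
    intro b hb b' hb' h
    rw [← hs b hb, ← hs b' hb', hg]
    exact hf _ (hsA b hb) _ (hsA b' hb') h
  exact_mod_cast this.trans ((card_le_univ _).trans_eq hX)

/-- Tuples in `A` that agree off a pair of indices are at most as many as values of a message. -/
lemma Recoverable.card_plane_le (hA : Recoverable F M A) (hM : 2 ≤ M) (hMK : M ≤ Fintype.card ι)
    {i k : ι} (hik : i ≠ k) (W : ι → V) :
    #{W' ∈ A | ∀ l, l ≠ i → l ≠ k → W l = W' l} ≤ Fintype.card V := by
  -- A support containing both free indices: its combination with demand `i` fixes `W i`, and then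
  -- `W k` by cancellation.
  obtain ⟨S, hS, hSc⟩ := Finset.exists_superset_card_eq (s := {i, k}) (n := M)
    (by rw [card_pair hik]; exact hM) hMK
  have hi : i ∈ S := hS (by simp)
  have hk : k ∈ S := hS (by simp)
  obtain ⟨c, hc0, hc⟩ := hA S hSc i hi
  refine (card_le_card_of_injOn (fun W' => ∑ l ∈ S, c l • W' l) (t := univ) (fun _ _ => by simp)
    ?_).trans_eq card_univ
  intro W₁ h₁ W₂ h₂ h
  simp only [coe_filter, Set.mem_ofPred_eq] at h₁ h₂
  have hWi : W₁ i = W₂ i := hc _ h₁.1 _ h₂.1 h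
  have hoff : ∀ l, l ≠ k → W₁ l = W₂ l := fun l hl => by
    by_cases hli : l = i
    · rw [hli, hWi]
    · rw [← h₁.2 l hli hl, h₂.2 l hli hl]
  funext l
  by_cases hl : l = k
  · subst hl
    exact eq_of_sum_eq hk (hc0 _ hk) h fun l _ hl => hoff l hl
  · exact hoff l hl

/-- The left side counts triples `(W, X, Y)` with `X`, `Y` on the two lines through `W`. The pair
`(X, Y)` determines `W`, which has its `i` coordinate from `Y` and all others from `X`, and both lie
in a common plane. -/
lemma Recoverable.sum_card_line_mul_le (hA : Recoverable F M A) (hM : 2 ≤ M)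
    (hMK : M ≤ Fintype.card ι) {i k : ι} (hik : i ≠ k) :
    ∑ W ∈ A, #(line A i W) * #(line A k W) ≤ Fintype.card V * #A := by
  calc ∑ W ∈ A, #(line A i W) * #(line A k W)
      = #(A.sigma fun W => line A i W ×ˢ line A k W) := by simp [card_sigma, card_product]
    _ ≤ #(A.sigma fun X => {Y ∈ A | ∀ l, l ≠ i → l ≠ k → X l = Y l}) := by
        refine card_le_card_of_injOn (fun p => ⟨p.2.1, p.2.2⟩) ?_ ?_
        · rintro ⟨W, X, Y⟩ h
          simp only [coe_sigma, Set.mem_sigma_iff, mem_coe, mem_product, mem_line,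
            mem_filter] at h ⊢
          exact ⟨h.2.1.1, h.2.2.1, fun l hi hk => (h.2.1.2 l hi).symm.trans (h.2.2.2 l hk)⟩
        · rintro ⟨W, X, Y⟩ h ⟨W', X', Y'⟩ h' heq
          simp only [coe_sigma, Set.mem_sigma_iff, mem_coe, mem_product, mem_line] at h h'
          simp only [Sigma.mk.injEq, heq_eq_eq] at heq
          obtain ⟨rfl, rfl⟩ := heq
          have : W = W' := by
            funext l
            by_cases hl : l = i
            · subst hl
              rw [h.2.2.2 _ hik, h'.2.2.2 _ hik]
            · rw [h.2.1.2 _ hl, h'.2.1.2 _ hl]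
          subst this
          rfl
    _ = ∑ X ∈ A, #{Y ∈ A | ∀ l, l ≠ i → l ≠ k → X l = Y l} := card_sigma _ _
    _ ≤ ∑ X ∈ A, Fintype.card V := sum_le_sum fun X _ => hA.card_plane_le hM hMK hik X
    _ = Fintype.card V * #A := by simp [mul_comm]

/-- An entropy argument for `W` uniform on `A`, with `v = #V`. Pairing all indices but one gives
`H(W off l) ≤ n log v` for `l = i, k` (`h1`), and the plane bound gives `H(W i | rest) + H(W k |
rest) ≤ log v` (`h2`). The chain rule adds these to `2 H(W) ≤ (2n + 1) log v`. Each inequality is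
proved through `log x ≤ x - 1`. -/
lemma Recoverable.two_mul_log_card_le_of_odd (hA : Recoverable F M A) (hM : 2 ≤ M) (hne : A.Nonempty)
    {n : ℕ} (hn : Fintype.card ι = 2 * n + 1) (h : M ≤ n + 1) :
    2 * Real.log #A ≤ Fintype.card ι * Real.log (Fintype.card V) := by
  obtain ⟨i, k, hik⟩ := Fintype.exists_pair_of_one_lt_card (α := ι) (by omega)
  have key : ∀ l : ι, ∑ W ∈ A, ((#(line A l W) : ℝ))⁻¹ ≤ (Fintype.card V ^ n : ℕ) := by
    intro l
    obtain ⟨f, hf⟩ := hA.exists_determines hM (P := univ.erase l) (n := n)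
      (by rw [card_erase_of_mem (mem_univ _), card_univ]; omega) h
    exact sum_inv_card_line_le (X := Fin n → V) (by simp) f
      fun W hW W' hW' hff i hi => hf W hW W' hW' hff i (by simp [hi])
  have hcA : (0 : ℝ) < #A := by exact_mod_cast hne.card_pos
  have hV : (0 : ℝ) < Fintype.card V := by exact_mod_cast Fintype.card_pos
  set v : ℝ := (Fintype.card V : ℝ) with hv
  have hpos : ∀ l, ∀ W ∈ A, (0 : ℝ) < #(line A l W) := fun l W hW => by
    exact_mod_cast card_line_pos hW
  have h1 : ∀ l : ι, ∑ W ∈ A, (Real.log #A - n * Real.log v - Real.log #(line A l W)) ≤ 0 := by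
    intro l
    calc ∑ W ∈ A, (Real.log #A - n * Real.log v - Real.log #(line A l W))
        ≤ ∑ W ∈ A, (#A / v ^ n * (#(line A l W) : ℝ)⁻¹ - 1) := by
          refine sum_le_sum fun W hW => ?_
          have hl := hpos l W hW
          have := Real.log_le_sub_one_of_pos (x := #A / v ^ n * (#(line A l W) : ℝ)⁻¹)
            (by positivity)
          rw [Real.log_mul (by positivity) (by positivity), Real.log_div (by positivity)
            (by positivity), Real.log_inv, Real.log_pow] at this
          linarith
      _ = #A / v ^ n * ∑ W ∈ A, (#(line A l W) : ℝ)⁻¹ - #A := by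
          rw [sum_sub_distrib, mul_sum]; simp
      _ ≤ #A / v ^ n * v ^ n - #A := by
          have := key l
          push_cast at this
          gcongr
      _ = 0 := by field_simp; ring
  have h2 : ∑ W ∈ A, (Real.log #(line A i W) + Real.log #(line A k W) - Real.log v) ≤ 0 := by
    calc ∑ W ∈ A, (Real.log #(line A i W) + Real.log #(line A k W) - Real.log v)
        ≤ ∑ W ∈ A, ((#(line A i W) * #(line A k W) : ℝ) / v - 1) := by
          refine sum_le_sum fun W hW => ?_
          have hi := hpos i W hW
          have hk := hpos k W hW
          have := Real.log_le_sub_one_of_pos (x := (#(line A i W) * #(line A k W) : ℝ) / v)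
            (by positivity)
          rwa [Real.log_div (by positivity) (by positivity), Real.log_mul (by positivity)
            (by positivity)] at this
      _ = (∑ W ∈ A, (#(line A i W) * #(line A k W) : ℝ)) / v - #A := by
          rw [sum_sub_distrib, sum_div]; simp
      _ ≤ (v * #A) / v - #A := by
          have : (∑ W ∈ A, (#(line A i W) * #(line A k W) : ℝ)) ≤ v * #A := by
            simp only [hv]
            exact_mod_cast hA.sum_card_line_mul_le hM (by omega) hik
          gcongr
      _ = 0 := by field_simp; ring
  have h3 : ∑ W ∈ A, (2 * Real.log #A - (2 * n + 1) * Real.log v) ≤ 0 := by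
    have := add_le_add (add_le_add (h1 i) (h1 k)) h2
    rw [← sum_add_distrib, ← sum_add_distrib] at this
    calc _ = _ := sum_congr rfl fun W _ => by ring
      _ ≤ _ := this
      _ = 0 := by simp
  rw [sum_const, nsmul_eq_mul] at h3
  have h4 := nonpos_of_mul_nonpos_right h3 hcA
  rw [hn]; push_cast
  linarith

/-- The logarithm of the number of tuples, in terms of the logarithm of the number of values of a
single message. -/
lemma Recoverable.log_card_le (hA : Recoverable F M A) (hM : 2 ≤ M) (hMK : M ≤ Fintype.card ι)
    (hne : A.Nonempty) :
    Real.log #A ≤ max ((Fintype.card ι : ℝ) / 2) (M - 1) * Real.log (Fintype.card V) := by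
  have hV : 0 ≤ Real.log (Fintype.card V) := Real.log_natCast_nonneg _
  have hcA : (0 : ℝ) < #A := by exact_mod_cast hne.card_pos
  have of_pow : ∀ n : ℕ, #A ≤ Fintype.card V ^ n →
      Real.log #A ≤ n * Real.log (Fintype.card V) := fun n hn => by
    rw [← Real.log_pow]
    exact Real.log_le_log hcA (by exact_mod_cast hn)
  by_cases h : Fintype.card ι + 2 ≤ 2 * M
  · refine (of_pow _ (hA.card_le_of_large hM hMK h)).trans ?_
    gcongr
    rw [Nat.cast_sub (by omega)]
    simp
  · rcases Nat.even_or_odd' (Fintype.card ι) with ⟨n, hn | hn⟩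
    · refine (of_pow _ (hA.card_le_of_even hM hn (by omega))).trans ?_
      gcongr
      refine le_trans ?_ (le_max_left _ _)
      rw [hn]; push_cast; linarith
    · have := hA.two_mul_log_card_le_of_odd hM hne hn (by omega)
      refine le_trans (b := (Fintype.card ι : ℝ) / 2 * Real.log (Fintype.card V))
        (by linarith) ?_
      gcongr
      exact le_max_left _ _

end Combinatorics

end PCSI

/-! ### Converse: from small fibres to a bound on the download -/

namespace PCSI

open Finset in
/-- Expected length of a uniquely decodable code, for a uniform source with small fibers. -/
lemma card_mul_le_sum_length_mul_log {X B : Type} [Fintype X] [Nonempty X] [Fintype B]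
    [Nontrivial B] (ans : X → List B)
    (hcode : InformationTheory.UniquelyDecodable (Set.range ans)) [DecidableEq (List B)] {β : ℝ}
    (hβ : ∀ x, Real.log #{x' | ans x' = ans x} ≤ β) :
    Fintype.card X * (Real.log (Fintype.card X) - β)
      ≤ (∑ x, ((ans x).length : ℝ)) * Real.log (Fintype.card B) := by
  set b : ℝ := (Fintype.card B : ℝ) with hb
  set N : ℝ := (Fintype.card X : ℝ) with hN
  have hbpos : 0 < b := by rw [hb]; exact_mod_cast Fintype.card_pos
  have hNpos : 0 < N := by rw [hN]; exact_mod_cast Fintype.card_pos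
  have hfib : ∀ x, (0 : ℝ) < #{x' | ans x' = ans x} := fun x => by
    exact_mod_cast card_pos.mpr ⟨x, by simp⟩
  -- Kraft–McMillan with the weight of each codeword spread evenly over its fibre: a subprobability
  -- on `X`, to be compared with the uniform law by `log x ≤ x - 1`.
  have kraft : ∑ x, (1 / b) ^ (ans x).length * (#{x' | ans x' = ans x} : ℝ)⁻¹ ≤ 1 := by
    have hk := InformationTheory.kraft_mcmillan_inequality (S := univ.image ans) (α := B)
      (by simpa using hcode)
    refine le_trans (le_of_eq ?_) hk
    rw [← Finset.sum_fiberwise_of_maps_to (t := univ.image ans) (g := ans)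
      (fun x _ => mem_image_of_mem _ (mem_univ x))]
    refine sum_congr rfl fun w hw => ?_
    obtain ⟨x, -, rfl⟩ := mem_image.mp hw
    rw [sum_congr rfl (g := fun _ => (1 / b) ^ (ans x).length * (#{x' | ans x' = ans x} : ℝ)⁻¹)]
    · rw [sum_const, nsmul_eq_mul]
      have := (hfib x).ne'
      rw [mul_left_comm, mul_inv_cancel₀ this, mul_one]
    · intro y hy
      rw [(mem_filter.mp hy).2]
  have : ∑ x, (Real.log N - (ans x).length * Real.log b - β) ≤ 0 := by
    calc ∑ x, (Real.log N - (ans x).length * Real.log b - β)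
        ≤ ∑ x, (N * ((1 / b) ^ (ans x).length * (#{x' | ans x' = ans x} : ℝ)⁻¹) - 1) := by
          refine sum_le_sum fun x _ => ?_
          have hx := hfib x
          have := Real.log_le_sub_one_of_pos
            (x := N * ((1 / b) ^ (ans x).length * (#{x' | ans x' = ans x} : ℝ)⁻¹))
            (by positivity)
          rw [Real.log_mul (by positivity) (by positivity), Real.log_mul (by positivity)
            (by positivity), Real.log_inv, Real.log_pow, one_div, Real.log_inv] at this
          rw [one_div]
          linarith [hβ x]
      _ = N * ∑ x, (1 / b) ^ (ans x).length * (#{x' | ans x' = ans x} : ℝ)⁻¹ - N := by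
          rw [sum_sub_distrib, mul_sum]; simp [hN]
      _ ≤ N * 1 - N := by gcongr
      _ = 0 := by ring
  rw [sum_sub_distrib, sum_sub_distrib, ← sum_mul] at this
  simp only [sum_const, nsmul_eq_mul, card_univ, ← hN] at this
  linarith

lemma tsum_bind_mul {α β : Type} (p : PMF α) (f : α → PMF β) (g : β → ℝ≥0∞) :
    ∑' b, p.bind f b * g b = ∑' a, p a * ∑' b, f a b * g b := by
  simp_rw [PMF.bind_apply, ← ENNReal.tsum_mul_right, ← ENNReal.tsum_mul_left]
  rw [ENNReal.tsum_comm]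
  simp_rw [mul_assoc]

lemma tsum_map_mul {α β : Type} (p : PMF α) (f : α → β) (g : β → ℝ≥0∞) :
    ∑' b, p.map f b * g b = ∑' a, p a * g (f a) := by
  classical
  rw [← PMF.bind_pure_comp, tsum_bind_mul]
  refine tsum_congr fun a => ?_
  congr 1
  rw [tsum_eq_single (f a)]
  · simp
  · intro b hb
    simp [PMF.pure_apply, hb]

lemma le_tsum_mul {α : Type} (p : PMF α) (h : α → ℝ≥0∞) (c : ℝ≥0∞)
    (hc : ∀ a ∈ p.support, c ≤ h a) : c ≤ ∑' a, p a * h a := by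
  calc c = ∑' a, p a * c := by rw [ENNReal.tsum_mul_right, p.tsum_coe, one_mul]
    _ ≤ _ := ENNReal.tsum_le_tsum fun a => by
      by_cases ha : p a = 0
      · simp [ha]
      · gcongr
        exact hc a ((p.mem_support_iff a).mpr ha)

/-- The coefficient of the message with index `i` in the side information. -/
noncomputable def coeff {F : Type} [Field F] {K M : ℕ} (S : Support K M) (Λ : Fin M → Fˣ)
    (i : Fin K) : Fˣ :=
  if h : i ∈ S.1 then Λ ((S.1.orderIsoOfFin S.2).symm ⟨i, h⟩) else 1

lemma sideInfo_eq {F : Type} [Field F] {K M L : ℕ} (S : Support K M) (Λ : Fin M → Fˣ)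
    (W : Messages F K L) : sideInfo S Λ W = ∑ i ∈ S.1, (coeff S Λ i : F) • W i := by
  rw [← Finset.sum_coe_sort, ← Equiv.sum_comp (S.1.orderIsoOfFin S.2).toEquiv]
  refine Finset.sum_congr rfl fun m _ => ?_
  have : (S.1.orderIsoOfFin S.2).symm ⟨S.1.orderEmbOfFin S.2 m, S.1.orderEmbOfFin_mem S.2 m⟩ = m :=
    (S.1.orderIsoOfFin S.2).symm_apply_apply m
  simp [coeff, this]

namespace Scheme

variable {F : Type} [Field F] [Fintype F] {K M : ℕ}

-- Query and messages are independent given `(S, θ, Λ)`, so the two draws commute; drawing `W` last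
-- exposes uniform messages for a fixed query.
open Classical in
lemma law_eq (s : Scheme F K M) (hM : 1 < M) (hMK : M ≤ K) :
    s.law hM hMK =
      haveI := support_nonempty hMK
      (PMF.uniformOfFintype (Support K M)).bind fun S =>
      (PMF.uniformOfFinset S.1 (S.finset_nonempty hM)).bind fun θ =>
      (PMF.uniformOfFintype (Fin M → Fˣ)).bind fun Λ =>
      (s.query S θ Λ).bind fun Q =>
      (PMF.uniformOfFintype (Messages F K s.L)).map fun W => ⟨S, θ, Λ, W, Q⟩ := by
  simp only [law, ← PMF.bind_pure_comp]
  congr 1; funext S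
  congr 1; funext θ
  congr 1; funext Λ
  exact PMF.bind_comm _ _ _

lemma mem_support_law (s : Scheme F K M) (hM : 1 < M) (hMK : M ≤ K)
    (o : Outcome F K M s.L s.Query) :
    o ∈ (s.law hM hMK).support ↔ o.θ ∈ o.S.1 ∧ o.Q ∈ (s.query o.S o.θ o.Λ).support := by
  classical
  rw [law]
  simp only [PMF.mem_support_bind_iff, PMF.support_map, Set.mem_image,
    PMF.mem_support_uniformOfFinset_iff]
  constructor
  · rintro ⟨S, -, θ, hθ, Λ, -, W, -, Q, hQ, rfl⟩
    exact ⟨hθ, hQ⟩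
  · rintro ⟨hθ, hQ⟩
    exact ⟨o.S, by simp, o.θ, hθ, o.Λ, by simp, o.W, by simp, o.Q, hQ, rfl⟩

lemma exists_query_of_private {s : Scheme F K M} {hM : 1 < M} {hMK : M ≤ K}
    (hp : s.Private hM hMK) {Q : s.Query} {S₀ : Support K M} {θ₀ : Fin K} {Λ₀ : Fin M → Fˣ}
    (hθ₀ : θ₀ ∈ S₀.1) (hQ : Q ∈ (s.query S₀ θ₀ Λ₀).support) {S : Support K M} {θ : Fin K}
    (hθ : θ ∈ S.1) : ∃ Λ, Q ∈ (s.query S θ Λ).support := by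
  -- The zero message tuple is an arbitrary choice: every tuple has positive probability.
  have h := hp (θ, S) (Q, 0)
  obtain ⟨Λ₁⟩ : Nonempty (Fin M → Fˣ) := inferInstance
  obtain ⟨Q₁, hQ₁⟩ := (s.query S θ Λ₁).support_nonempty
  have h1 : ((s.law hM hMK).map fun o => (o.θ, o.S)) (θ, S) ≠ 0 := by
    rw [← PMF.mem_support_iff, PMF.mem_support_map_iff]
    exact ⟨⟨S, θ, Λ₁, 0, Q₁⟩, (s.mem_support_law hM hMK _).mpr ⟨hθ, hQ₁⟩, rfl⟩
  have h2 : ((s.law hM hMK).map fun o => (o.Q, o.W)) (Q, 0) ≠ 0 := by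
    rw [← PMF.mem_support_iff, PMF.mem_support_map_iff]
    exact ⟨⟨S₀, θ₀, Λ₀, 0, Q⟩, (s.mem_support_law hM hMK _).mpr ⟨hθ₀, hQ⟩, rfl⟩
  have h3 := h.trans_ne (mul_ne_zero h1 h2)
  rw [← PMF.mem_support_iff, PMF.mem_support_map_iff] at h3
  obtain ⟨o, ho, heq⟩ := h3
  rw [s.mem_support_law] at ho
  simp only [Prod.mk.injEq] at heq
  obtain ⟨⟨rfl, rfl⟩, rfl, -⟩ := heq
  exact ⟨o.Λ, ho.2⟩

-- Privacy supplies some `Λ` that could have produced `Q` for the given `S` and `θ`; its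
-- coefficients are the combination, and the decoder shows that they work.
open Classical in
lemma recoverable_fiber {s : Scheme F K M} {hM : 1 < M} {hMK : M ≤ K}
    (hp : s.Private hM hMK) (hc : s.Correct hM hMK) {Q : s.Query} {S₀ : Support K M}
    {θ₀ : Fin K} {Λ₀ : Fin M → Fˣ} (hθ₀ : θ₀ ∈ S₀.1) (hQ : Q ∈ (s.query S₀ θ₀ Λ₀).support)
    (W₀ : Messages F K s.L) :
    Recoverable F M (Finset.univ.filter fun W => s.answer Q W = s.answer Q W₀) := by
  intro S hS θ hθ
  obtain ⟨Λ, hΛ⟩ := exists_query_of_private hp hθ₀ hQ (S := ⟨S, hS⟩) hθ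
  refine ⟨fun i => coeff ⟨S, hS⟩ Λ i, fun i _ => Units.ne_zero _, fun W hW W' hW' h => ?_⟩
  obtain ⟨decode, hd⟩ := hc
  have h1 := hd ⟨⟨S, hS⟩, θ, Λ, W, Q⟩ ((s.mem_support_law hM hMK _).mpr ⟨hθ, hΛ⟩)
  have h2 := hd ⟨⟨S, hS⟩, θ, Λ, W', Q⟩ ((s.mem_support_law hM hMK _).mpr ⟨hθ, hΛ⟩)
  simp only [Finset.mem_filter, Finset.mem_univ, true_and] at hW hW'
  simp only [sideInfo_eq] at h1 h2
  rw [← h1, ← h2, h, hW, hW']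

lemma log_card_messages (F : Type) [Fintype F] (K L : ℕ) :
    Real.log (Fintype.card (Messages F K L)) = K * L * Real.log (Fintype.card F) := by
  simp [mul_assoc]

/-- The converse bound on the download of a private and correct scheme. -/
lemma le_download {s : Scheme F K M} {hM : 1 < M} {hMK : M ≤ K}
    (hp : s.Private hM hMK) (hc : s.Correct hM hMK) :
    ENNReal.ofReal ((K - max ((K : ℝ) / 2) (M - 1)) * s.L) ≤ s.download hM hMK := by
  classical
  have hq : 0 < Real.log (Fintype.card F) :=
    Real.log_pos (by exact_mod_cast Fintype.one_lt_card)
  have hb : 0 < Real.log (Fintype.card s.Letter) :=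
    Real.log_pos (by exact_mod_cast Fintype.one_lt_card)
  have hl : 0 < Real.logb (Fintype.card F) (Fintype.card s.Letter) := div_pos hb hq
  set τ : ℝ := K - max ((K : ℝ) / 2) (M - 1) with hτ
  rw [download]
  have hE : ENNReal.ofReal (τ * s.L / Real.logb (Fintype.card F) (Fintype.card s.Letter)) ≤
      ∑' o, s.law hM hMK o * ((s.answer o.Q o.W).length : ℝ≥0∞) := by
    -- The bound holds for each fixed `S`, `θ`, `Λ`, `Q` in the support, so it suffices to average
    -- over the messages.
    rw [law_eq, tsum_bind_mul]
    refine le_tsum_mul _ _ _ fun S _ => ?_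
    rw [tsum_bind_mul]
    refine le_tsum_mul _ _ _ fun θ hθ => ?_
    rw [PMF.mem_support_uniformOfFinset_iff] at hθ
    rw [tsum_bind_mul]
    refine le_tsum_mul _ _ _ fun Λ _ => ?_
    rw [tsum_bind_mul]
    refine le_tsum_mul _ _ _ fun Q hQ => ?_
    rw [tsum_map_mul, tsum_fintype]
    have hbound := card_mul_le_sum_length_mul_log (s.answer Q) (s.answer_code Q)
      (β := max ((K : ℝ) / 2) (M - 1) * Real.log (Fintype.card (Fin s.L → F))) fun W₀ => by
        have := (recoverable_fiber hp hc hθ hQ W₀).log_card_le (by omega) (by simpa using hMK)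
          ⟨W₀, by simp⟩
        simpa using this
    have hN : (0 : ℝ) < Fintype.card (Messages F K s.L) := by exact_mod_cast Fintype.card_pos
    have hlogV : Real.log (Fintype.card (Fin s.L → F)) = s.L * Real.log (Fintype.card F) := by
      simp
    rw [log_card_messages, hlogV] at hbound
    have hreal : τ * s.L / Real.logb (Fintype.card F) (Fintype.card s.Letter) ≤
        ∑ W, ((Fintype.card (Messages F K s.L) : ℝ))⁻¹ * ((s.answer Q W).length : ℝ) := by
      rw [← Finset.mul_sum, div_le_iff₀ hl, Real.logb, ← mul_div_assoc, le_div_iff₀ hq,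
        mul_assoc (_⁻¹), ← div_eq_inv_mul, le_div_iff₀ hN]
      refine le_trans (le_of_eq ?_) hbound
      rw [hτ]; ring
    refine (ENNReal.ofReal_le_ofReal hreal).trans_eq ?_
    rw [ENNReal.ofReal_sum_of_nonneg fun _ _ => by positivity]
    refine Finset.sum_congr rfl fun W _ => ?_
    rw [ENNReal.ofReal_mul (by positivity), ENNReal.ofReal_inv_of_pos hN, ENNReal.ofReal_natCast,
      ENNReal.ofReal_natCast, PMF.uniformOfFintype_apply]
  calc ENNReal.ofReal (τ * s.L)
      = ENNReal.ofReal (τ * s.L / Real.logb (Fintype.card F) (Fintype.card s.Letter)) *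
          ENNReal.ofReal (Real.logb (Fintype.card F) (Fintype.card s.Letter)) := by
        rw [← ENNReal.ofReal_mul' hl.le, div_mul_cancel₀ _ hl.ne']
    _ ≤ _ := by gcongr

lemma rate_le {s : Scheme F K M} {hM : 1 < M} {hMK : M ≤ K}
    (hp : s.Private hM hMK) (hc : s.Correct hM hMK) :
    s.rate hM hMK ≤ ENNReal.ofReal (max (2 / (K : ℝ)) (1 / ((K : ℝ) - (M : ℝ) + 1))) := by
  have hK : (0 : ℝ) < K := by exact_mod_cast (by omega : 0 < K)
  have hMK' : (M : ℝ) ≤ K := by exact_mod_cast hMK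
  have hL : (0 : ℝ) < s.L := by exact_mod_cast s.L_pos
  have hτ : 0 < (K : ℝ) - max ((K : ℝ) / 2) (M - 1) := by
    rw [sub_pos, max_lt_iff]; constructor <;> linarith
  calc s.rate hM hMK
      ≤ (s.L : ℝ≥0∞) / ENNReal.ofReal ((K - max ((K : ℝ) / 2) (M - 1)) * s.L) :=
        ENNReal.div_le_div_left (le_download hp hc) _
    _ = ENNReal.ofReal (1 / (K - max ((K : ℝ) / 2) (M - 1))) := by
        rw [← ENNReal.ofReal_natCast, ← ENNReal.ofReal_div_of_pos (by positivity)]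
        congr 1
        field_simp
    _ ≤ _ := by
        apply ENNReal.ofReal_le_ofReal
        rcases max_choice ((K : ℝ) / 2) (M - 1) with h | h <;> rw [h]
        · refine le_trans (le_of_eq ?_) (le_max_left _ _)
          field_simp; ring
        · refine le_trans (le_of_eq ?_) (le_max_right _ _)
          congr 1; ring

end Scheme

lemma supCapacity_le (K M : ℕ) (hM : 1 < M) (hMK : M ≤ K) :
    supCapacity K M hM hMK
      ≤ ENNReal.ofReal (max (2 / (K : ℝ)) (1 / ((K : ℝ) - (M : ℝ) + 1))) :=
  iSup_le fun _ => iSup_le fun _ => iSup_le fun _ => iSup_le fun _ => iSup_le fun hp =>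
    iSup_le fun hc => Scheme.rate_le hp hc

end PCSI

/-! ### Achievability: private queries by random scaling -/

namespace PCSI

lemma uniquelyDecodable_of_length_eq {B : Type} {C : Set (List B)} {n : ℕ} (hn : 0 < n)
    (hC : ∀ w ∈ C, w.length = n) : InformationTheory.UniquelyDecodable C := by
  intro L₁
  induction L₁ with
  | nil =>
    intro L₂ _ h₂ h
    cases L₂ with
    | nil => rfl
    | cons w L₂ =>
      have := congrArg List.length h
      simp [hC w (h₂ w (by simp))] at this
      omega
  | cons v L₁ ih =>
    intro L₂ h₁ h₂ h
    cases L₂ with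
    | nil =>
      have := congrArg List.length h
      simp [hC v (h₁ v (by simp))] at this
      omega
    | cons w L₂ =>
      rw [List.flatten_cons, List.flatten_cons] at h
      obtain ⟨hvw, ht⟩ := List.append_inj h
        ((hC v (h₁ v (by simp))).trans (hC w (h₂ w (by simp))).symm)
      rw [hvw, ih L₂ (fun u hu => h₁ u (by simp [hu])) (fun u hu => h₂ u (by simp [hu])) ht]

lemma indep_of_map_eq {Ω α β : Type} {p : PMF Ω} {X : Ω → α} {Y : Ω → β} (μ : PMF α)
    (ν : PMF β) (h : p.map (fun ω => (X ω, Y ω)) = μ.bind fun a => ν.map fun b => (a, b)) :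
    Indep p X Y := by
  classical
  have hX : p.map X = μ := by
    have := congrArg (PMF.map Prod.fst) h
    have hconst : ∀ a : α, PMF.map (fun _ => a) ν = PMF.pure a := fun a => PMF.map_const ν a
    simpa only [PMF.map_comp, PMF.map_bind, Function.comp_def, hconst, PMF.bind_pure] using this
  have hY : p.map Y = ν := by
    have := congrArg (PMF.map Prod.snd) h
    simp only [PMF.map_comp, PMF.map_bind, Function.comp_def, PMF.bind_const] at this
    exact this.trans (PMF.map_id ν)
  intro a b
  rw [h, hX, hY, PMF.bind_apply, tsum_eq_single a]
  · congr 1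
    rw [PMF.map_apply, tsum_eq_single b]
    · simp
    · intro b' hb'
      simp [hb'.symm]
  · intro a' ha'
    rw [PMF.map_apply]
    simp [ha'.symm]

lemma eq_uniformOfFintype_of_smul {G : Type} [Group G] [Fintype G] (p : PMF G)
    (hp : ∀ e d, p (e * d) = p d) : p = PMF.uniformOfFintype G := by
  have hc : ∀ d, p d = p 1 := fun d => by simpa using hp d 1
  have h1 : (Fintype.card G : ℝ≥0∞) * p 1 = 1 := by
    rw [← p.tsum_coe, tsum_fintype, Finset.sum_congr rfl fun d _ => hc d]
    simp
  ext d
  rw [PMF.uniformOfFintype_apply, hc]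
  exact ENNReal.eq_inv_of_mul_eq_one_left (by rwa [mul_comm])

namespace Scheme

variable {F : Type} [Field F] [Fintype F] {K M : ℕ}

open Classical in
lemma private_of_bind_query_eq (s : Scheme F K M) (hM : 1 < M) (hMK : M ≤ K) (ν : PMF s.Query)
    (hν : ∀ S θ, (PMF.uniformOfFintype (Fin M → Fˣ)).bind (s.query S θ) = ν) :
    s.Private hM hMK := by
  have := support_nonempty hMK
  refine indep_of_map_eq
    ((PMF.uniformOfFintype (Support K M)).bind fun S =>
      (PMF.uniformOfFinset S.1 (S.finset_nonempty hM)).bind fun θ => PMF.pure (θ, S))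
    (ν.bind fun Q => (PMF.uniformOfFintype (Messages F K s.L)).map fun W => (Q, W)) ?_
  rw [law_eq]
  simp only [PMF.map_bind, PMF.map_comp, PMF.bind_bind, PMF.pure_bind]
  congr 1; funext S
  congr 1; funext θ
  rw [← hν S θ, PMF.bind_bind]
  rfl

lemma correct_of_injective (s : Scheme F K M) (hM : 1 < M) (hMK : M ≤ K)
    (h : ∀ (S : Support K M), ∀ θ ∈ S.1, ∀ (Λ : Fin M → Fˣ), ∀ Q ∈ (s.query S θ Λ).support,
      ∀ W W' : Messages F K s.L, s.answer Q W = s.answer Q W' →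
        sideInfo S Λ W = sideInfo S Λ W' → W θ = W' θ) : s.Correct hM hMK := by
  classical
  -- Decode from any tuple consistent with the data; the default 0 is never reached on the support
  -- of the law.
  refine ⟨fun a Q Y S Λ θ => if h : ∃ W : Messages F K s.L,
    s.answer Q W = a ∧ sideInfo S Λ W = Y then h.choose θ else 0, fun o ho => ?_⟩
  obtain ⟨hθ, hQ⟩ := (s.mem_support_law hM hMK _).mp ho
  have hex : ∃ W : Messages F K s.L, s.answer o.Q W = s.answer o.Q o.W ∧
      sideInfo o.S o.Λ W = sideInfo o.S o.Λ o.W := ⟨o.W, rfl, rfl⟩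
  beta_reduce
  rw [dif_pos hex]
  exact h o.S o.θ hθ o.Λ o.Q hQ _ _ hex.choose_spec.1 hex.choose_spec.2

end Scheme

section Scaling

variable {F : Type} [Field F] [Fintype F] {K M : ℕ}

open Classical in
/-- The scalings `d` for which `d i * c i` is the side information coefficient for `i ∈ S`, except
for `i = θ`, where it is not. -/
noncomputable def scalings (c : Fin K → Fˣ) (S : Support K M) (θ : Fin K) (Λ : Fin M → Fˣ) :
    Finset (Fin K → Fˣ) :=
  {d | ∀ i ∈ S.1, d i * c i = coeff S Λ i ↔ i ≠ θ}

lemma mem_scalings {c : Fin K → Fˣ} {S : Support K M} {θ : Fin K} {Λ : Fin M → Fˣ}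
    {d : Fin K → Fˣ} :
    d ∈ scalings c S θ Λ ↔ ∀ i ∈ S.1, d i * c i = coeff S Λ i ↔ i ≠ θ := by
  simp [scalings]

lemma scalings_nonempty (hF : 2 < Fintype.card F) (c : Fin K → Fˣ) (S : Support K M) (θ : Fin K)
    (Λ : Fin M → Fˣ) : (scalings c S θ Λ).Nonempty := by
  classical
  obtain ⟨μ, hμ⟩ : ∃ μ : Fˣ, μ ≠ 1 := by
    refine Fintype.exists_ne_of_one_lt_card ?_ 1
    rw [Fintype.card_units]; omega
  refine ⟨fun i => coeff S Λ i * (c i)⁻¹ * if i = θ then μ else 1, ?_⟩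
  rw [mem_scalings]
  intro i hi
  by_cases h : i = θ
  · simp [h, mul_right_comm, hμ]
  · simp [h]

lemma coeff_mul {F : Type} [Field F] {K M : ℕ} (e : Fin K → Fˣ) (S : Support K M) (Λ : Fin M → Fˣ) {i : Fin K} (hi : i ∈ S.1) :
    coeff S ((fun m => e (S.1.orderEmbOfFin S.2 m)) * Λ) i = e i * coeff S Λ i := by
  have : S.1.orderEmbOfFin S.2 ((S.1.orderIsoOfFin S.2).symm ⟨i, hi⟩) = i := by
    have := (S.1.orderIsoOfFin S.2).apply_symm_apply ⟨i, hi⟩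
    exact congrArg Subtype.val this
  simp [coeff, hi, this]

lemma mul_mem_scalings (c e d : Fin K → Fˣ) (S : Support K M) (θ : Fin K) (Λ : Fin M → Fˣ) :
    e * d ∈ scalings c S θ ((fun m => e (S.1.orderEmbOfFin S.2 m)) * Λ) ↔
      d ∈ scalings c S θ Λ := by
  simp only [mem_scalings]
  refine forall₂_congr fun i hi => ?_
  rw [coeff_mul e S Λ hi, Pi.mul_apply, mul_assoc, mul_right_inj]

-- Multiplying a scaling by `e` carries the admissible set for `Λ` bijectively onto that for `Λ`
-- multiplied by `e` on `S`. As `Λ` is uniform, the averaged law is translation invariant on a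
-- finite group, hence uniform.
open Classical in
lemma bind_scalings (hF : 2 < Fintype.card F) (c : Fin K → Fˣ) (S : Support K M) (θ : Fin K) :
    ((PMF.uniformOfFintype (Fin M → Fˣ)).bind fun Λ =>
      PMF.uniformOfFinset (scalings c S θ Λ) (scalings_nonempty hF c S θ Λ)) =
        PMF.uniformOfFintype (Fin K → Fˣ) := by
  apply eq_uniformOfFintype_of_smul
  intro e d
  rw [PMF.bind_apply, PMF.bind_apply,
    ← (Equiv.mulLeft (fun m => e (S.1.orderEmbOfFin S.2 m))).tsum_eq]
  refine tsum_congr fun Λ => ?_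
  rw [PMF.uniformOfFintype_apply, PMF.uniformOfFintype_apply, Equiv.coe_mulLeft]
  congr 1
  by_cases hd : d ∈ scalings c S θ Λ
  swap
  · rw [PMF.uniformOfFinset_apply_of_notMem _ hd, PMF.uniformOfFinset_apply_of_notMem]
    exact fun h => hd ((mul_mem_scalings ..).mp h)
  rw [PMF.uniformOfFinset_apply_of_mem _ hd,
    PMF.uniformOfFinset_apply_of_mem _ ((mul_mem_scalings ..).mpr hd)]
  congr 2
  symm
  refine Finset.card_bij (fun d _ => e * d) (fun d hd => (mul_mem_scalings ..).mpr hd)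
    (fun d _ d' _ h => mul_left_cancel h) (fun d hd => ⟨e⁻¹ * d, ?_, by simp⟩)
  rw [← mul_mem_scalings c e, mul_inv_cancel_left]
  exact hd

/-- The scheme in which the server scales the messages as the query says, and applies a fixed map
`g` to the result. -/
noncomputable def scalingScheme (hF : 2 < Fintype.card F) (c : Support K M → Fin K → Fˣ)
    {B : Type} [Fintype B] [Nontrivial B] {n : ℕ} (hn : 0 < n) (g : (Fin K → F) → Fin n → B) :
    Scheme F K M where
  L := 1
  L_pos := one_pos
  Query := Fin K → Fˣ
  query S θ Λ := PMF.uniformOfFinset (scalings (c S) S θ Λ) (scalings_nonempty hF _ S θ Λ)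
  Letter := B
  answer d W := List.ofFn (g fun i => d i * W i 0)
  answer_code d := uniquelyDecodable_of_length_eq hn (by rintro _ ⟨W, rfl⟩; simp)

variable (hF : 2 < Fintype.card F) (c : Support K M → Fin K → Fˣ)
  {B : Type} [Fintype B] [Nontrivial B] {n : ℕ} (hn : 0 < n) (g : (Fin K → F) → Fin n → B)
  (hM : 1 < M) (hMK : M ≤ K)

open Classical in
lemma scalingScheme_private : (scalingScheme hF c hn g).Private hM hMK :=
  Scheme.private_of_bind_query_eq _ hM hMK (PMF.uniformOfFintype (Fin K → Fˣ))
    fun S θ => bind_scalings hF (c S) S θ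

/-- `g x` and the side information, where the coefficient at `θ` is off by a factor `ρ ≠ 1`,
determine `x θ`. -/
def Decodes : Prop :=
  ∀ (S : Support K M), ∀ θ ∈ S.1, ∀ (ρ : F) (x x' : Fin K → F), ρ ≠ 1 → ρ ≠ 0 → g x = g x' →
    (∑ i ∈ S.1.erase θ, (c S i : F) * x i + ρ * (c S θ * x θ)
      = ∑ i ∈ S.1.erase θ, (c S i : F) * x' i + ρ * (c S θ * x' θ)) → x θ = x' θ

/-- In terms of the scaled messages the side information has coefficients `c`, up to a factor `ρ =
coeff S Λ θ / (d θ * c θ)` at `θ`; this is the form that `Decodes` expects. -/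
lemma sideInfo_eq_of_mem_scalings {c : Fin K → Fˣ} {S : Support K M} {θ : Fin K}
    {Λ : Fin M → Fˣ} {d : Fin K → Fˣ} (hθ : θ ∈ S.1) (hd : d ∈ scalings c S θ Λ)
    (W : Messages F K 1) :
    sideInfo S Λ W 0 = ∑ i ∈ S.1.erase θ, (c i : F) * (d i * W i 0) +
      (coeff S Λ θ / (d θ * c θ) : F) * (c θ * (d θ * W θ 0)) := by
  rw [mem_scalings] at hd
  rw [sideInfo_eq, ← Finset.sum_erase_add _ _ hθ, Pi.add_apply, Finset.sum_apply]
  congr 1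
  · refine Finset.sum_congr rfl fun i hi => ?_
    rw [← (hd i (Finset.mem_of_mem_erase hi)).mpr (Finset.ne_of_mem_erase hi)]
    simp only [Pi.smul_apply, smul_eq_mul, Units.val_mul]
    ring
  · have h1 := (d θ).ne_zero
    have h2 := (c θ).ne_zero
    simp only [Pi.smul_apply, smul_eq_mul]
    field_simp

lemma scalingScheme_correct (hg : Decodes c g) : (scalingScheme hF c hn g).Correct hM hMK := by
  apply Scheme.correct_of_injective
  intro S θ hθ Λ (Q : Fin K → Fˣ) hQ (W : Messages F K 1) (W' : Messages F K 1) h1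
    (h2 : sideInfo S Λ W = sideInfo S Λ W')
  replace hQ : Q ∈ scalings (c S) S θ Λ :=
    (PMF.mem_support_uniformOfFinset_iff (scalings_nonempty hF _ S θ Λ) Q).mp hQ
  have hd := mem_scalings.mp hQ
  have hx := hg S θ hθ (coeff S Λ θ / (Q θ * c S θ) : F) (fun i => Q i * W i 0)
    (fun i => Q i * W' i 0)
    (by
      intro h
      rw [div_eq_one_iff_eq (mul_ne_zero (Units.ne_zero _) (Units.ne_zero _))] at h
      exact (hd θ hθ).mp (Units.ext (by simpa using h.symm)) rfl)
    (div_ne_zero (Units.ne_zero _) (mul_ne_zero (Units.ne_zero _) (Units.ne_zero _)))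
    (List.ofFn_injective h1)
    (by rw [← sideInfo_eq_of_mem_scalings hθ hQ, ← sideInfo_eq_of_mem_scalings hθ hQ, h2])
  funext l
  have hl : l = (0 : Fin 1) := Subsingleton.elim (α := Fin 1) _ _
  subst hl
  exact mul_left_cancel₀ (Q θ).ne_zero hx

lemma scalingScheme_download : (scalingScheme hF c hn g).download hM hMK =
    ENNReal.ofReal (n * Real.logb (Fintype.card F) (Fintype.card B)) := by
  have : ∀ o : Outcome F K M 1 (Fin K → Fˣ),
      ((scalingScheme hF c hn g).answer o.Q o.W).length = n := fun o => by
    simp [scalingScheme]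
  rw [Scheme.download, ENNReal.ofReal_mul (by positivity), ENNReal.ofReal_natCast]
  congr 1
  calc _ = ∑' o, (scalingScheme hF c hn g).law hM hMK o * (n : ℝ≥0∞) :=
        tsum_congr fun o => by rw [this o]
    _ = n := by rw [ENNReal.tsum_mul_right, PMF.tsum_coe, one_mul]

lemma le_supCapacity (hF : 2 < Fintype.card F) (hn : 0 < n) (hg : Decodes c g) :
    ENNReal.ofReal (1 / (n * Real.logb (Fintype.card F) (Fintype.card B)))
      ≤ supCapacity K M hM hMK := by
  have hpos : 0 < n * Real.logb (Fintype.card F) (Fintype.card B) := by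
    have := Real.logb_pos (b := Fintype.card F) (x := Fintype.card B)
      (by exact_mod_cast Fintype.one_lt_card) (by exact_mod_cast Fintype.one_lt_card)
    positivity
  refine le_trans (le_of_eq ?_) (le_iSup_of_le F <| le_iSup_of_le inferInstance <|
    le_iSup_of_le inferInstance <| le_iSup_of_le (scalingScheme hF c hn g) <|
    le_iSup_of_le (scalingScheme_private hF c hn g hM hMK) <|
    le_iSup_of_le (scalingScheme_correct hF c hn g hM hMK hg) le_rfl)
  rw [Scheme.rate, scalingScheme_download, ENNReal.ofReal_div_of_pos hpos]
  simp [scalingScheme]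

end Scaling

end PCSI

/-! ### The two server maps and the final value -/

namespace PCSI

lemma natCast_injective {K p : ℕ} (hKp : K ≤ p) :
    Function.Injective fun i : Fin K => ((i : ℕ) : ZMod p) := by
  intro i j h
  have h' := (ZMod.natCast_eq_natCast_iff' _ _ _).mp h
  rw [Nat.mod_eq_of_lt (by omega), Nat.mod_eq_of_lt (by omega)] at h'
  exact Fin.ext h'

open Polynomial in
/-- The Reed-Solomon code of dimension `K - M + 1` has a word with any given support of size `M`. -/
lemma exists_decodes_reedSolomon {F : Type} [Field F] [Fintype F] {K M : ℕ} (α : Fin K → F)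
    (hα : Function.Injective α) :
    ∃ c : Support K M → Fin K → Fˣ,
      Decodes c fun (x : Fin K → F) (j : Fin (K - M + 1)) => ∑ i, α i ^ (j : ℕ) * x i := by
  classical
  -- Of degree `K - M` and vanishing exactly at the points outside `S`, so its values are a
  -- combination of the `K - M + 1` power rows supported exactly on `S`.
  let P : Support K M → F[X] := fun S => ∏ k ∈ S.1ᶜ, (X - C (α k))
  have hdeg : ∀ S, (P S).natDegree < K - M + 1 := fun S => by
    rw [natDegree_prod_of_monic _ _ fun k _ => monic_X_sub_C _]
    simp [Finset.card_compl, S.2]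
  have hne : ∀ S, ∀ i ∈ S.1, (P S).eval (α i) ≠ 0 := fun S i hi => by
    rw [eval_prod, Finset.prod_ne_zero_iff]
    intro k hk
    rw [eval_sub, eval_X, eval_C, sub_ne_zero]
    rintro h
    rw [hα h] at hi
    exact Finset.mem_compl.mp hk hi
  have hzero : ∀ S, ∀ i ∉ S.1, (P S).eval (α i) = 0 := fun S i hi => by
    rw [eval_prod, Finset.prod_eq_zero (Finset.mem_compl.mpr hi)]
    simp
  let c : Support K M → Fin K → Fˣ := fun S i =>
    if h : (P S).eval (α i) = 0 then 1 else Units.mk0 _ h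
  have hc : ∀ S, ∀ i ∈ S.1, (c S i : F) = (P S).eval (α i) := fun S i hi => by
    simp [c, hne S i hi]
  have hsum : ∀ S (x : Fin K → F), ∑ i ∈ S.1, (c S i : F) * x i =
      ∑ j : Fin (K - M + 1), (P S).coeff j * ∑ i, α i ^ (j : ℕ) * x i := fun S x => by
    calc ∑ i ∈ S.1, (c S i : F) * x i = ∑ i ∈ S.1, (P S).eval (α i) * x i :=
          Finset.sum_congr rfl fun i hi => by rw [hc S i hi]
      _ = ∑ i, (P S).eval (α i) * x i :=
          Finset.sum_subset (Finset.subset_univ _) fun i _ hi => by rw [hzero S i hi, zero_mul]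
      _ = ∑ i, ∑ j : Fin (K - M + 1), (P S).coeff j * (α i ^ (j : ℕ) * x i) := by
          refine Finset.sum_congr rfl fun i _ => ?_
          rw [eval_eq_sum_range' (hdeg S), ← Fin.sum_univ_eq_sum_range
            (fun j => (P S).coeff j * α i ^ j), Finset.sum_mul]
          simp_rw [mul_assoc]
      _ = _ := by
          rw [Finset.sum_comm]
          simp_rw [Finset.mul_sum]
  refine ⟨c, fun S θ hθ ρ x x' hρ _ hg h => ?_⟩
  have h1 : ∑ i ∈ S.1, (c S i : F) * x i = ∑ i ∈ S.1, (c S i : F) * x' i := by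
    rw [hsum, hsum]
    exact Finset.sum_congr rfl fun j _ => congrArg _ (congrFun hg j)
  rw [← Finset.sum_erase_add _ _ hθ, ← Finset.sum_erase_add _ _ hθ] at h1
  -- The answer gives the combination with factor 1 at `θ`, the side information the one with factor
  -- `ρ`; everything but `θ` cancels.
  have h2 : (ρ - 1) * ((c S θ : F) * (x θ - x' θ)) = 0 := by linear_combination h - h1
  rw [mul_eq_zero, mul_eq_zero, sub_eq_zero, sub_eq_zero] at h2
  rcases h2 with h2 | h2 | h2
  · exact absurd h2 hρ
  · exact absurd h2 (c S θ).ne_zero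
  · exact h2

/-- An additive map with a kernel of at most two elements, applied to all the messages. -/
lemma decodes_of_kernel {F B : Type} [Field F] [Fintype F] [AddCommGroup B] {K M : ℕ}
    (u : F →+ B) (hu : ∀ y z, u y = 0 → u z = 0 → y ≠ 0 → z ≠ 0 → y = z) :
    Decodes (fun (_ : Support K M) _ => 1) fun (x : Fin K → F) i => u (x i) := by
  intro S θ hθ ρ x x' hρ hρ0 hg h
  simp only [Units.val_one, one_mul] at h
  have hgi : ∀ i, u (x i) = u (x' i) := fun i => congrFun hg i
  have h1 := congrArg u h
  rw [map_add, map_add, map_sum, map_sum, Finset.sum_congr rfl fun i _ => hgi i,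
    add_right_inj] at h1
  by_contra hne
  have hy : x θ - x' θ ≠ 0 := sub_ne_zero.mpr hne
  -- Applying `u` to the side information puts `ρ` times the difference in the kernel. The
  -- difference is there too, and the kernel has at most one nonzero element, forcing `ρ = 1`.
  have := hu (ρ * (x θ - x' θ)) (x θ - x' θ)
    (by rw [mul_sub, map_sub, h1, sub_self]) (by rw [map_sub, hgi, sub_self])
    (mul_ne_zero hρ0 hy) hy
  exact hρ (mul_right_cancel₀ hy (this.trans (one_mul _).symm))

lemma exists_projection_galoisField :
    ∃ u : GaloisField 2 2 →+ ZMod 2, ∀ y z, u y = 0 → u z = 0 → y ≠ 0 → z ≠ 0 → y = z := by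
  let b : Module.Basis (Fin 2) (ZMod 2) (GaloisField 2 2) :=
    Module.finBasisOfFinrankEq _ _ (GaloisField.finrank 2 two_ne_zero)
  have h1 : ∀ y, b.coord 0 y = 0 → y ≠ 0 → b.repr y 1 = 1 := fun y h0 hy => by
    have : b.repr y 1 ≠ 0 := fun h1 => hy <| b.ext_elem fun i => by
      fin_cases i
      · simpa using h0
      · simpa using h1
    generalize b.repr y 1 = a at *
    revert a
    decide
  refine ⟨(b.coord 0).toAddMonoidHom, fun y z hy hz hy0 hz0 => b.ext_elem fun i => ?_⟩
  fin_cases i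
  · exact hy.trans hz.symm
  · exact (h1 y hy hy0).trans (h1 z hz hz0).symm

lemma two_div_le_supCapacity {K M : ℕ} (hM : 1 < M) (hMK : M ≤ K) :
    ENNReal.ofReal (2 / (K : ℝ)) ≤ supCapacity K M hM hMK := by
  obtain ⟨u, hu⟩ := exists_projection_galoisField
  let inst : Fintype (GaloisField 2 2) := Fintype.ofFinite _
  have hcard : Fintype.card (GaloisField 2 2) = 4 := by
    rw [← Nat.card_eq_fintype_card, GaloisField.card 2 2 two_ne_zero]; norm_num
  refine le_trans (le_of_eq ?_) (le_supCapacity _ _ hM hMK (by rw [hcard]; norm_num)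
    (by omega) (decodes_of_kernel u hu))
  have : Real.logb (4 : ℝ) 2 = 1 / 2 := by
    rw [Real.logb, show (4 : ℝ) = 2 ^ 2 by norm_num, Real.log_pow]
    have := Real.log_pos (one_lt_two (α := ℝ))
    field_simp
    norm_num
  rw [hcard, ZMod.card]
  push_cast
  rw [this]
  congr 1
  field_simp

lemma one_div_le_supCapacity {K M : ℕ} (hM : 1 < M) (hMK : M ≤ K) :
    ENNReal.ofReal (1 / ((K : ℝ) - (M : ℝ) + 1)) ≤ supCapacity K M hM hMK := by
  -- Large enough for `K` distinct evaluation points and for a unit other than 1.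
  obtain ⟨p, hKp, hp⟩ := Nat.exists_infinite_primes (K + 3)
  have : Fact p.Prime := ⟨hp⟩
  obtain ⟨c, hc⟩ := exists_decodes_reedSolomon (M := M) _ (natCast_injective (K := K) (p := p) (by omega))
  refine le_trans (le_of_eq ?_) (le_supCapacity _ _ hM hMK (by rw [ZMod.card]; omega)
    (by omega) hc)
  rw [Real.logb_self_eq_one (by rw [ZMod.card]; exact_mod_cast hp.one_lt)]
  push_cast [Nat.cast_sub hMK]
  simp

lemma supCapacity_eq (K M : ℕ) (hM : 1 < M) (hMK : M ≤ K) :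
    supCapacity K M hM hMK
      = ENNReal.ofReal (max (2 / (K : ℝ)) (1 / ((K : ℝ) - (M : ℝ) + 1))) := by
  refine le_antisymm (supCapacity_le K M hM hMK) ?_
  rw [ENNReal.ofReal_max]
  exact max_le (two_div_le_supCapacity hM hMK) (one_div_le_supCapacity hM hMK)

end PCSI

theorem theorem1 (K M : ℕ) (hM : 1 < M) (hMK : M ≤ K) :
    PCSI.supCapacity K M hM hMK
        = ENNReal.ofReal (max (2 / (K : ℝ)) (1 / ((K : ℝ) - (M : ℝ) + 1))) ∧
      ((M : ℝ) ≤ ((K : ℝ) + 1) / 2 →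
        PCSI.supCapacity K M hM hMK = ENNReal.ofReal (2 / (K : ℝ))) ∧
      (((K : ℝ) + 1) / 2 < (M : ℝ) →
        PCSI.supCapacity K M hM hMK
          = ENNReal.ofReal (1 / ((K : ℝ) - (M : ℝ) + 1))) := by
  have hK : (0 : ℝ) < K := by exact_mod_cast (by omega : 0 < K)
  have hMK' : (M : ℝ) ≤ K := by exact_mod_cast hMK
  refine ⟨PCSI.supCapacity_eq K M hM hMK, fun h => ?_, fun h => ?_⟩
  · rw [PCSI.supCapacity_eq, max_eq_left]
    rw [div_le_div_iff₀ (by linarith) hK]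
    linarith
  · rw [PCSI.supCapacity_eq, max_eq_right]
    -- Integrality matters: the comparison of the two rates turns at `2M = K + 2`, while the
    -- hypothesis only says `2M > K + 1`.
    have h2 : K + 2 ≤ 2 * M := by
      have : K + 1 < 2 * M := by
        have : (K : ℝ) + 1 < 2 * M := by linarith
        exact_mod_cast this
      omega
    have h3 : (K : ℝ) + 2 ≤ 2 * M := by exact_mod_cast h2
    rw [div_le_div_iff₀ hK (by linarith)]
    linarith
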